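/- Let $0 \le k \le m$ be integers and let $M \in \mathbb{R}^{m\times m}$ be symmetric positive definite. Let $Z$ be a random $m \times k$ real matrix with the matrix-variate normal distribution $\mathrm{MN}(0, M, I_k)$, i.e. with density $$(2\pi)^{-mk/2}\,|M|^{-k/2}\exp\!\Big(-\tfrac12\operatorname{tr}\big(M^{-1}ZZ^T\big)\Big)$$ with respect to Lebesgue measure on $\mathbb{R}^{m\times k}$. Let $$\mathcal{P}_{m,k} = \{P \in \mathbb{R}^{m\times m} : P^T = P,\ P^2 = P,\ \operatorname{rank}(P) = k\}$$ be the Grassmann manifold of $k$-dimensional subspaces of $\mathbb{R}^m$, each subspace being represented by the orthogonal projection onto it, and let the Haar measure on $\mathcal{P}_{m,k}$ be the probability measure invariant under $P \mapsto UPU^T$ for all orthogonal $U$. Then, almost surely, $Z^TZ$ is invertible and $P = Z(Z^TZ)^{-1}Z^T$ is an element of $\mathcal{P}_{m,k}$ whose range is the column space of $Z$; and, as a random point of $\mathcal{P}_{m,k}$, $P$ has the density $$f(P) = |M|^{-k/2}\,\big|I_m - P + M^{-1}P\big|^{-m/2}$$ with respect to the Haar measure (the matrix angular central Gaussian law). 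-/

import Mathlib

open MeasureTheory Matrix

namespace GrassmannNormal

/-! ### Lebesgue measure on real matrices -/

/-- The space of real `m × k` matrices with the product `σ`-algebra and Lebesgue measure
`∏ dY i j`. -/
noncomputable instance instMeasureSpaceMatrix (m k : ℕ) :
    MeasureSpace (Matrix (Fin m) (Fin k) ℝ) :=
  inferInstanceAs (MeasureSpace (Fin m → Fin k → ℝ))

instance instBorelSpaceMatrix (m k : ℕ) : BorelSpace (Matrix (Fin m) (Fin k) ℝ) :=
  inferInstanceAs (BorelSpace (Fin m → Fin k → ℝ))

/-! ### Matrix-variate normal distribution -/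

/-- The density of the matrix-variate normal distribution `MN(A, Λ₁, Λ₂)` on `m × k` matrices,
`(2π)^(-mk/2) |Λ₁|^(-k/2) |Λ₂|^(-m/2) etr(-½ Λ₁⁻¹ (Y - A) Λ₂⁻¹ (Y - A)ᵀ)`. -/
noncomputable def matrixNormalPDF {m k : ℕ} (A : Matrix (Fin m) (Fin k) ℝ)
    (Λ₁ : Matrix (Fin m) (Fin m) ℝ) (Λ₂ : Matrix (Fin k) (Fin k) ℝ)
    (Y : Matrix (Fin m) (Fin k) ℝ) : ℝ :=
  (2 * Real.pi) ^ (-((m : ℝ) * (k : ℝ)) / 2) * Λ₁.det ^ (-(k : ℝ) / 2) * Λ₂.det ^ (-(m : ℝ) / 2) *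
    Real.exp (Matrix.trace ((-(1 / 2) : ℝ) • (Λ₁⁻¹ * (Y - A) * Λ₂⁻¹ * (Y - A)ᵀ)))

/-- The matrix-variate normal distribution `MN(A, Λ₁, Λ₂)` with mean `A`, row covariance matrix
`Λ₁` and column covariance matrix `Λ₂` (both meant to be positive definite). -/
noncomputable def matrixNormal {m k : ℕ} (A : Matrix (Fin m) (Fin k) ℝ)
    (Λ₁ : Matrix (Fin m) (Fin m) ℝ) (Λ₂ : Matrix (Fin k) (Fin k) ℝ) :
    Measure (Matrix (Fin m) (Fin k) ℝ) :=
  volume.withDensity fun Y => ENNReal.ofReal (matrixNormalPDF A Λ₁ Λ₂ Y)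

/-! ### The Grassmann manifold as a space of projection matrices -/

/-- The Grassmann manifold of `k`-dimensional subspaces of `ℝᵐ`, a subspace being represented by
the matrix of the orthogonal projection onto it: symmetric idempotent matrices of rank `k`.
It carries the topology and the Borel `σ`-algebra of a subspace of `ℝ^(m × m)`. -/
abbrev Gr (m k : ℕ) : Type :=
  {P : Matrix (Fin m) (Fin m) ℝ // Pᵀ = P ∧ P * P = P ∧ P.rank = k}

lemma ortho_mul_transpose {m : ℕ} (U : Matrix.orthogonalGroup (Fin m) ℝ) :
    (U : Matrix (Fin m) (Fin m) ℝ) * (U : Matrix (Fin m) (Fin m) ℝ)ᵀ = 1 :=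
  (Matrix.mem_orthogonalGroup_iff _ _).1 U.2

lemma ortho_transpose_mul {m : ℕ} (U : Matrix.orthogonalGroup (Fin m) ℝ) :
    (U : Matrix (Fin m) (Fin m) ℝ)ᵀ * (U : Matrix (Fin m) (Fin m) ℝ) = 1 :=
  (Matrix.mem_orthogonalGroup_iff' _ _).1 U.2

/-- The action of the orthogonal group on the Grassmann manifold: the projection onto the image
of a subspace under `U` is `U P Uᵀ`. -/
def rotate {m k : ℕ} (U : Matrix.orthogonalGroup (Fin m) ℝ) (P : Gr m k) : Gr m k :=
  ⟨(U : Matrix (Fin m) (Fin m) ℝ) * P.1 * (U : Matrix (Fin m) (Fin m) ℝ)ᵀ, by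
    obtain ⟨P, h1, h2, h3⟩ := P
    have hU := ortho_transpose_mul U
    have hd : IsUnit (U : Matrix (Fin m) (Fin m) ℝ).det :=
      (Matrix.isUnit_iff_isUnit_det _).1 (IsUnit.of_mul_eq_one_right _ hU)
    refine ⟨?_, ?_, ?_⟩
    · simp [Matrix.transpose_mul, h1, Matrix.mul_assoc]
    · calc _ = (U : Matrix (Fin m) (Fin m) ℝ) * P *
            ((U : Matrix (Fin m) (Fin m) ℝ)ᵀ * (U : Matrix (Fin m) (Fin m) ℝ)) * P *
              (U : Matrix (Fin m) (Fin m) ℝ)ᵀ := by simp only [Matrix.mul_assoc]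
        _ = (U : Matrix (Fin m) (Fin m) ℝ) * (P * P) * (U : Matrix (Fin m) (Fin m) ℝ)ᵀ := by
            rw [hU, Matrix.mul_one, Matrix.mul_assoc _ P P]
        _ = (U : Matrix (Fin m) (Fin m) ℝ) * P * (U : Matrix (Fin m) (Fin m) ℝ)ᵀ := by rw [h2]
    · rw [Matrix.rank_mul_eq_left_of_isUnit_det _ _ (by rwa [Matrix.det_transpose]),
        Matrix.rank_mul_eq_right_of_isUnit_det _ _ hd, h3]⟩

/-- The span of the first `k` coordinate vectors, as a point of the Grassmann manifold. -/
noncomputable def basePoint {m k : ℕ} (hk : k ≤ m) : Gr m k :=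
  ⟨Matrix.diagonal fun i : Fin m => if (i : ℕ) < k then (1 : ℝ) else 0, by
    refine ⟨Matrix.diagonal_transpose _, ?_, ?_⟩
    · rw [Matrix.diagonal_mul_diagonal]
      congr 1
      funext i
      split_ifs <;> simp
    · rw [Matrix.rank_diagonal, Fintype.card_subtype]
      have : (Finset.univ.filter fun i : Fin m => (if (i : ℕ) < k then (1 : ℝ) else 0) ≠ 0)
          = Finset.univ.filter fun i : Fin m => (i : ℕ) < k := by
        ext i
        simp
      rw [this, Fin.card_filter_val_lt, min_eq_right hk]⟩

/-! ### Haar measure -/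

instance instCompactSpaceOrtho (m : ℕ) : CompactSpace (Matrix.orthogonalGroup (Fin m) ℝ) := by
  have hc : IsClosed (Matrix.orthogonalGroup (Fin m) ℝ : Set (Matrix (Fin m) (Fin m) ℝ)) :=
    isClosed_unitary
  have hK : IsCompact (Set.univ.pi fun _ => Set.univ.pi fun _ => Set.Icc (-1 : ℝ) 1 :
      Set (Fin m → Fin m → ℝ)) :=
    isCompact_univ_pi fun _ => isCompact_univ_pi fun _ => isCompact_Icc
  have hs : (Matrix.orthogonalGroup (Fin m) ℝ : Set (Matrix (Fin m) (Fin m) ℝ)) ⊆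
      (Set.univ.pi fun _ => Set.univ.pi fun _ => Set.Icc (-1 : ℝ) 1 :
        Set (Fin m → Fin m → ℝ)) := by
    intro U hU i _ j _
    exact abs_le.1 (entry_norm_bound_of_unitary (𝕜 := ℝ) hU i j)
  exact isCompact_iff_compactSpace.1 (hK.of_isClosed_subset hc hs)

/-- Haar measure on the compact group `O(m)`, of total mass one. -/
noncomputable def orthoHaar (m : ℕ) : Measure (Matrix.orthogonalGroup (Fin m) ℝ) :=
  Measure.haarMeasure ⊤

lemma orthoHaar_univ (m : ℕ) : orthoHaar m Set.univ = 1 :=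
  Measure.haarMeasure_self (K₀ := (⊤ : TopologicalSpace.PositiveCompacts
    (Matrix.orthogonalGroup (Fin m) ℝ)))

lemma continuous_rotate {m k : ℕ} (P : Gr m k) : Continuous fun U => rotate U P := by
  unfold rotate
  fun_prop

lemma continuous_rotate' {m k : ℕ} (U : Matrix.orthogonalGroup (Fin m) ℝ) :
    Continuous (rotate U : Gr m k → Gr m k) := by
  unfold rotate
  fun_prop

/-- The Haar (uniform) measure on the Grassmann manifold: the `O(m)`-invariant probability measure,
that is, the law of a uniformly rotated `k`-dimensional subspace of `ℝᵐ`. -/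
noncomputable def grassmannHaar {m k : ℕ} (hk : k ≤ m) : Measure (Gr m k) :=
  (orthoHaar m).map fun U => rotate U (basePoint hk)

lemma grassmannHaar_isProbabilityMeasure {m k : ℕ} (hk : k ≤ m) :
    IsProbabilityMeasure (grassmannHaar hk) := by
  constructor
  rw [grassmannHaar, Measure.map_apply (continuous_rotate _).measurable MeasurableSet.univ,
    Set.preimage_univ, orthoHaar_univ]

lemma grassmannHaar_map_rotate {m k : ℕ} (hk : k ≤ m) (U : Matrix.orthogonalGroup (Fin m) ℝ) :
    (grassmannHaar hk).map (rotate U) = grassmannHaar hk := by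
  have h : rotate U ∘ (fun V => rotate V (basePoint hk)) =
      (fun V => rotate V (basePoint hk)) ∘ fun V => U * V := by
    funext V
    apply Subtype.ext
    simp [rotate, Matrix.transpose_mul, Matrix.mul_assoc]
  have hU : Measurable fun V : Matrix.orthogonalGroup (Fin m) ℝ => U * V :=
    (continuous_const_mul U).measurable
  rw [grassmannHaar, Measure.map_map (continuous_rotate' U).measurable
    (continuous_rotate _).measurable, h, ← Measure.map_map (continuous_rotate _).measurable hU]
  congr 1
  exact map_mul_left_eq_self (Measure.haarMeasure
    (⊤ : TopologicalSpace.PositiveCompacts (Matrix.orthogonalGroup (Fin m) ℝ))) U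

/-! ### The matrix angular central Gaussian density -/

/-- The matrix `Z (ZᵀZ)⁻¹ Zᵀ`. -/
noncomputable def colProj {m k : ℕ} (Z : Matrix (Fin m) (Fin k) ℝ) : Matrix (Fin m) (Fin m) ℝ :=
  Z * (Zᵀ * Z)⁻¹ * Zᵀ

/-- The function `P ↦ |M|^(-k/2) |I - P + M⁻¹ P|^(-m/2)` on the Grassmann manifold. -/
noncomputable def macgPDF {m k : ℕ} (M : Matrix (Fin m) (Fin m) ℝ) (P : Gr m k) : ℝ :=
  M.det ^ (-(k : ℝ) / 2) * (1 - P.1 + M⁻¹ * P.1).det ^ (-(m : ℝ) / 2)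

end GrassmannNormal

namespace GrassmannNormal

/-! The measure `|ZᵀZ|^(-m/2) dZ` is invariant under `Z ↦ ZA` with `A` invertible, and the column
space does not change under these maps. Up to `(2π)^(-mk/2)`, the density of `MN(0, M, I)` against
this measure is `f(P)` times `w(ZᵀM⁻¹Z)`, where `w(S) = |S|^(m/2) etr(-S/2)`, because `|I - P +
M⁻¹P| = |ZᵀM⁻¹Z| / |ZᵀZ|` (`det_one_sub_colProj_add`, `matrixNormalPDF_eq_macgPDF_mul`).

The central point is `lintegral_mul_wishartWeight_eq`: integrating `H(Z) w(ZᵀTZ)`, with `H` a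
function of the column space, gives a value independent of the positive definite `T`. No polar
decomposition is needed: an auxiliary `k × k` variable `A`, weighted by the two-sided invariant
measure of the linear group, averages over each orbit `Z ↦ ZA`, and Tonelli does the rest. Replacing
`T = M⁻¹` by `T = I` turns the integral of `g(P)` under `MN(0, M, I)` into that of `f(P) g(P)` under
`MN(0, I, I)`.

Under the standard normal law `P` is rotation invariant, hence uniform, since the orthogonal group
acts transitively on projections of rank `k` (`eq_grassmannHaar`). -/

instance instSecondCountableTopologyMatrix (m k : ℕ) :
    SecondCountableTopology (Matrix (Fin m) (Fin k) ℝ) :=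
  inferInstanceAs (SecondCountableTopology (Fin m → Fin k → ℝ))

instance instSecondCountableTopologyOrtho (m : ℕ) :
    SecondCountableTopology (Matrix.orthogonalGroup (Fin m) ℝ) :=
  Topology.IsInducing.subtypeVal.secondCountableTopology

instance instSecondCountableTopologyGr (m k : ℕ) : SecondCountableTopology (Gr m k) :=
  Topology.IsInducing.subtypeVal.secondCountableTopology

instance instSigmaFiniteMatrix (m k : ℕ) :
    SigmaFinite (volume : Measure (Matrix (Fin m) (Fin k) ℝ)) :=
  inferInstanceAs (SigmaFinite (volume : Measure (Fin m → Fin k → ℝ)))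

instance instIsAddHaarMeasureMatrix (m k : ℕ) :
    (volume : Measure (Matrix (Fin m) (Fin k) ℝ)).IsAddHaarMeasure :=
  Measure.pi.isAddHaarMeasure (fun _ : Fin m => (volume : Measure (Fin k → ℝ)))

/-! ### Linear changes of variables -/

lemma lintegral_comp_linearMap {m k : ℕ}
    (f : Matrix (Fin m) (Fin k) ℝ →ₗ[ℝ] Matrix (Fin m) (Fin k) ℝ) (hf : LinearMap.det f ≠ 0)
    {g : Matrix (Fin m) (Fin k) ℝ → ENNReal} (hg : Measurable g) :
    ENNReal.ofReal |LinearMap.det f| * ∫⁻ Z, g (f Z) = ∫⁻ Z, g Z := by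
  have hm : Measurable f := f.continuous_of_finiteDimensional.measurable
  have h : Measure.map f volume = ENNReal.ofReal |(LinearMap.det f)⁻¹| • volume :=
    @Measure.map_linearMap_addHaar_eq_smul_addHaar (Fin m → Fin k → ℝ) _ _ _
      (instBorelSpaceMatrix m k) _ volume (instIsAddHaarMeasureMatrix m k) f hf
  rw [← lintegral_map hg hm, h, lintegral_smul_measure, smul_eq_mul, ← mul_assoc,
    ← ENNReal.ofReal_mul (abs_nonneg _), ← abs_mul, mul_inv_cancel₀ hf]
  simp

/-- Right multiplication acts on each of the `m` rows separately, through `Aᵀ`. -/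
lemma det_mulRightLinearMap {m k : ℕ} (A : Matrix (Fin k) (Fin k) ℝ) :
    LinearMap.det (mulRightLinearMap (Fin m) ℝ A) = A.det ^ m := by
  have h : (mulRightLinearMap (Fin m) ℝ A : (Fin m → Fin k → ℝ) →ₗ[ℝ] (Fin m → Fin k → ℝ)) =
      LinearMap.pi fun i => (Matrix.toLin' Aᵀ).comp (LinearMap.proj i) := by
    ext1 Z
    funext i
    change (Matrix.of Z * A) i = Aᵀ *ᵥ Z i
    rw [mulVec_transpose]
    rfl
  exact (congrArg LinearMap.det h).trans ((LinearMap.det_pi _).trans (by simp))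

/-- Transposition conjugates this map to right multiplication by `Aᵀ`. -/
lemma det_mulLeftLinearMap {m k : ℕ} (A : Matrix (Fin m) (Fin m) ℝ) :
    LinearMap.det (mulLeftLinearMap (Fin k) ℝ A) = A.det ^ k := by
  rw [← det_transpose, ← det_mulRightLinearMap,
    ← LinearMap.det_conj _ (transposeLinearEquiv (Fin k) (Fin m) ℝ ℝ)]
  congr 1
  ext1 Z
  simp

lemma lintegral_mul_right {m k : ℕ} (A : Matrix (Fin k) (Fin k) ℝ) (hA : A.det ≠ 0)
    {g : Matrix (Fin m) (Fin k) ℝ → ENNReal} (hg : Measurable g) :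
    ENNReal.ofReal (|A.det| ^ m) * ∫⁻ Z : Matrix (Fin m) (Fin k) ℝ, g (Z * A) = ∫⁻ Z, g Z := by
  have := lintegral_comp_linearMap (mulRightLinearMap (Fin m) ℝ A)
    (by rw [det_mulRightLinearMap]; exact pow_ne_zero _ hA) hg
  simpa [det_mulRightLinearMap] using this

lemma lintegral_mul_left {m k : ℕ} (A : Matrix (Fin m) (Fin m) ℝ) (hA : A.det ≠ 0)
    {g : Matrix (Fin m) (Fin k) ℝ → ENNReal} (hg : Measurable g) :
    ENNReal.ofReal (|A.det| ^ k) * ∫⁻ Z : Matrix (Fin m) (Fin k) ℝ, g (A * Z) = ∫⁻ Z, g Z := by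
  have := lintegral_comp_linearMap (mulLeftLinearMap (Fin k) ℝ A)
    (by rw [det_mulLeftLinearMap]; exact pow_ne_zero _ hA) hg
  simpa [det_mulLeftLinearMap] using this

/-! ### Almost every matrix has full rank -/

/-- On each line `Y + tE` the determinant is the characteristic polynomial of `-EᵀY` at `t`, so it
has finitely many zeros. By Fubini some single `t` works for almost every `Y`, and translation
invariance removes it. -/
lemma ae_det_transpose_mul_ne_zero {m k : ℕ} {E : Matrix (Fin m) (Fin k) ℝ} (hE : Eᵀ * E = 1) :
    ∀ᵐ Z : Matrix (Fin m) (Fin k) ℝ, (Eᵀ * Z).det ≠ 0 := by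
  have hc : Continuous fun p : Matrix (Fin m) (Fin k) ℝ × ℝ => (Eᵀ * (p.1 + p.2 • E)).det := by
    fun_prop
  have hm : MeasurableSet
      {p : Matrix (Fin m) (Fin k) ℝ × ℝ | (Eᵀ * (p.1 + p.2 • E)).det ≠ 0} :=
    (isOpen_ne_fun hc continuous_const).measurableSet
  have h1 : ∀ Y : Matrix (Fin m) (Fin k) ℝ, ∀ᵐ t : ℝ, (Eᵀ * (Y + t • E)).det ≠ 0 := by
    intro Y
    have : {t : ℝ | ¬ (Eᵀ * (Y + t • E)).det ≠ 0} ⊆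
        {t : ℝ | (-(Eᵀ * Y)).charpoly.IsRoot t} := by
      intro t ht
      simp only [ne_eq, not_not, Set.mem_ofPred_eq] at ht
      rw [Set.mem_ofPred_eq, Polynomial.IsRoot, eval_charpoly, ← ht, Matrix.mul_add,
        Matrix.mul_smul, hE, scalar_apply, smul_one_eq_diagonal, sub_neg_eq_add, add_comm]
    exact measure_mono_null this
      ((Polynomial.finite_setOfPred_isRoot (charpoly_monic _).ne_zero).measure_zero _)
  have h2 : ∀ᵐ t : ℝ, ∀ᵐ Y : Matrix (Fin m) (Fin k) ℝ, (Eᵀ * (Y + t • E)).det ≠ 0 :=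
    (Measure.ae_ae_comm hm).1 (Filter.Eventually.of_forall h1)
  obtain ⟨t, ht⟩ := h2.exists
  have := (measurePreserving_add_right (volume : Measure (Matrix (Fin m) (Fin k) ℝ))
    (-(t • E))).quasiMeasurePreserving.ae ht
  simpa using this

/-- The coordinate inclusion of `ℝᵏ` in `ℝᵐ` is an isometry. -/
lemma submatrix_castLE_transpose_mul {m k : ℕ} (hk : k ≤ m) :
    ((1 : Matrix (Fin m) (Fin m) ℝ).submatrix id (Fin.castLE hk))ᵀ *
      (1 : Matrix (Fin m) (Fin m) ℝ).submatrix id (Fin.castLE hk) = 1 := by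
  rw [transpose_submatrix, ← submatrix_mul _ _ _ _ _ Function.bijective_id]
  simpa using submatrix_one _ (Fin.castLE_injective hk)

lemma ae_injective {m k : ℕ} (hk : k ≤ m) :
    ∀ᵐ Z : Matrix (Fin m) (Fin k) ℝ, Function.Injective Z.mulVec := by
  filter_upwards [ae_det_transpose_mul_ne_zero (submatrix_castLE_transpose_mul hk)] with Z hZ
  have h := mulVec_injective_of_isUnit ((isUnit_iff_isUnit_det _).2 (isUnit_iff_ne_zero.2 hZ))
  intro x y hxy
  apply h
  simp only [← mulVec_mulVec]
  rw [hxy]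

lemma posDef_transpose_mul_mul {m k : ℕ} {T : Matrix (Fin m) (Fin m) ℝ} (hT : T.PosDef)
    {Z : Matrix (Fin m) (Fin k) ℝ} (hZ : Function.Injective Z.mulVec) : (Zᵀ * T * Z).PosDef := by
  simpa using hT.conjTranspose_mul_mul_same hZ

lemma ae_det_pos {m k : ℕ} (hk : k ≤ m) {T : Matrix (Fin m) (Fin m) ℝ} (hT : T.PosDef) :
    ∀ᵐ Z : Matrix (Fin m) (Fin k) ℝ, 0 < (Zᵀ * T * Z).det := by
  filter_upwards [ae_injective hk] with Z hZ using (posDef_transpose_mul_mul hT hZ).det_pos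

lemma exists_transpose_mul_self {k : ℕ} {S : Matrix (Fin k) (Fin k) ℝ} (hS : S.PosDef) :
    ∃ B : Matrix (Fin k) (Fin k) ℝ, B.det ≠ 0 ∧ S = Bᵀ * B := by
  open scoped MatrixOrder in
  obtain ⟨B, hB⟩ := CStarAlgebra.nonneg_iff_eq_star_mul_self.1 hS.posSemidef.nonneg
  rw [star_eq_conjTranspose, conjTranspose_eq_transpose_of_trivial] at hB
  refine ⟨B, fun h => hS.det_pos.ne' ?_, hB⟩
  rw [hB, det_mul, h, mul_zero]

/-! ### Measurability of matrix operations -/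

lemma measurable_matrix_mul {α : Type*} [MeasurableSpace α] {l m n : ℕ}
    {f : α → Matrix (Fin l) (Fin m) ℝ} {g : α → Matrix (Fin m) (Fin n) ℝ}
    (hf : Measurable f) (hg : Measurable g) : Measurable fun x => f x * g x := by
  have hc : Continuous fun p : Matrix (Fin l) (Fin m) ℝ × Matrix (Fin m) (Fin n) ℝ =>
      p.1 * p.2 := by fun_prop
  exact hc.measurable.comp (hf.prodMk hg)

lemma measurable_matrix_transpose {α : Type*} [MeasurableSpace α] {m n : ℕ}
    {f : α → Matrix (Fin m) (Fin n) ℝ} (hf : Measurable f) : Measurable fun x => (f x)ᵀ :=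
  (continuous_id.matrix_transpose).measurable.comp hf

lemma measurable_matrix_det {α : Type*} [MeasurableSpace α] {n : ℕ}
    {f : α → Matrix (Fin n) (Fin n) ℝ} (hf : Measurable f) : Measurable fun x => (f x).det :=
  (continuous_id.matrix_det).measurable.comp hf

/-- The formula by determinant and adjugate also covers singular matrices, since `0⁻¹ = 0`. -/
lemma measurable_matrix_inv {α : Type*} [MeasurableSpace α] {n : ℕ}
    {f : α → Matrix (Fin n) (Fin n) ℝ} (hf : Measurable f) : Measurable fun x => (f x)⁻¹ := by
  have hc : Continuous fun p : ℝ × Matrix (Fin n) (Fin n) ℝ => p.1 • p.2 := by fun_prop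
  simp only [Matrix.inv_def, Ring.inverse_eq_inv']
  exact hc.measurable.comp ((measurable_matrix_det hf).inv.prodMk
    ((continuous_id.matrix_adjugate).measurable.comp hf))

/-! ### Weights on square and rectangular matrices -/

/-- The weight `|ZᵀZ|^(-m/2)`, which makes Lebesgue measure on `m × k` matrices invariant under
right multiplication by invertible matrices. -/
noncomputable def gramWeight {m k : ℕ} (Z : Matrix (Fin m) (Fin k) ℝ) : ENNReal :=
  ENNReal.ofReal ((Zᵀ * Z).det ^ (-(m : ℝ) / 2))

/-- The function `S ↦ |S|^(m/2) etr(-S/2)`. -/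
noncomputable def wishartWeight (m : ℕ) {k : ℕ} (S : Matrix (Fin k) (Fin k) ℝ) : ENNReal :=
  ENNReal.ofReal (S.det ^ ((m : ℝ) / 2) * Real.exp (-(1 / 2) * S.trace))

lemma measurable_gramWeight {m k : ℕ} :
    Measurable (gramWeight : Matrix (Fin m) (Fin k) ℝ → ENNReal) :=
  ((measurable_matrix_det (measurable_matrix_mul (measurable_matrix_transpose measurable_id)
    measurable_id)).pow_const _).ennreal_ofReal

lemma measurable_wishartWeight (m k : ℕ) :
    Measurable (wishartWeight m : Matrix (Fin k) (Fin k) ℝ → ENNReal) := by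
  have h : Continuous (trace : Matrix (Fin k) (Fin k) ℝ → ℝ) := continuous_id.matrix_trace
  have := h.measurable
  exact (((measurable_matrix_det measurable_id).pow_const _).mul
    (this.const_mul _).exp).ennreal_ofReal

lemma sq_rpow_neg_half (a : ℝ) (m : ℕ) :
    (a ^ 2) ^ (-(m : ℝ) / 2) = (|a| ^ m)⁻¹ := by
  rw [← sq_abs, ← Real.rpow_natCast |a| 2, ← Real.rpow_mul (abs_nonneg a)]
  rw [show ((2 : ℕ) : ℝ) * (-(m : ℝ) / 2) = -(m : ℝ) by push_cast; ring,
    Real.rpow_neg (abs_nonneg a), Real.rpow_natCast]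

lemma det_transpose_mul_self_nonneg {m k : ℕ} (Z : Matrix (Fin m) (Fin k) ℝ) :
    0 ≤ (Zᵀ * Z).det := by
  simpa using (posSemidef_conjTranspose_mul_self Z).det_nonneg

/-- With `a = det A`, the Jacobian `|a|^m` of `Z ↦ ZA` cancels the factor by which the weight
scales. -/
lemma ofReal_mul_gramWeight {m k : ℕ} {Z Z' : Matrix (Fin m) (Fin k) ℝ} {a : ℝ} (ha : a ≠ 0)
    (h : (Z'ᵀ * Z').det = a ^ 2 * (Zᵀ * Z).det) :
    ENNReal.ofReal (|a| ^ m) * gramWeight Z' = gramWeight Z := by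
  have hp : 0 < |a| ^ m := pow_pos (abs_pos.2 ha) m
  rw [gramWeight, gramWeight, ← ENNReal.ofReal_mul hp.le, h,
    Real.mul_rpow (sq_nonneg a) (det_transpose_mul_self_nonneg Z), sq_rpow_neg_half, ← mul_assoc,
    mul_inv_cancel₀ hp.ne', one_mul]

lemma lintegral_gramWeight_mul_right {m k : ℕ} (A : Matrix (Fin k) (Fin k) ℝ) (hA : A.det ≠ 0)
    {F : Matrix (Fin m) (Fin k) ℝ → ENNReal} (hF : Measurable F) :
    ∫⁻ Z : Matrix (Fin m) (Fin k) ℝ, gramWeight Z * F (Z * A) = ∫⁻ Z, gramWeight Z * F Z := by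
  rw [← lintegral_mul_right A hA (g := fun Z => gramWeight Z * F Z) (measurable_gramWeight.mul hF),
    ← lintegral_const_mul' _ _ ENNReal.ofReal_ne_top]
  refine lintegral_congr fun Z => ?_
  rw [← mul_assoc, ofReal_mul_gramWeight hA]
  rw [transpose_mul, Matrix.mul_assoc, det_mul, ← Matrix.mul_assoc, det_mul, det_transpose]
  ring

/-- Left invariance is special to square matrices, where left and right multiplication have the same
Jacobian. -/
lemma lintegral_gramWeight_mul_left {k : ℕ} (A : Matrix (Fin k) (Fin k) ℝ) (hA : A.det ≠ 0)
    {F : Matrix (Fin k) (Fin k) ℝ → ENNReal} (hF : Measurable F) :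
    ∫⁻ Z, gramWeight Z * F (A * Z) = ∫⁻ Z, gramWeight Z * F Z := by
  rw [← lintegral_mul_left A hA (g := fun Z => gramWeight Z * F Z) (measurable_gramWeight.mul hF),
    ← lintegral_const_mul' _ _ ENNReal.ofReal_ne_top]
  refine lintegral_congr fun Z => ?_
  rw [← mul_assoc, ofReal_mul_gramWeight hA]
  simp only [det_mul, det_transpose]
  ring

/-- Writing `S = BᵀB` gives `ASAᵀ = (ABᵀ)(ABᵀ)ᵀ`, and the invariant measure absorbs `Bᵀ`. -/
lemma lintegral_gramWeight_conj {k : ℕ} {F : Matrix (Fin k) (Fin k) ℝ → ENNReal}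
    (hF : Measurable F) {S : Matrix (Fin k) (Fin k) ℝ} (hS : S.PosDef) :
    ∫⁻ A : Matrix (Fin k) (Fin k) ℝ, gramWeight A * F (A * S * Aᵀ) =
      ∫⁻ A : Matrix (Fin k) (Fin k) ℝ, gramWeight A * F (A * Aᵀ) := by
  obtain ⟨B, hB, rfl⟩ := exists_transpose_mul_self hS
  have := lintegral_gramWeight_mul_right Bᵀ (by rwa [det_transpose])
    (F := fun A => F (A * Aᵀ))
    (hF.comp (measurable_matrix_mul measurable_id (measurable_matrix_transpose measurable_id)))
  simpa only [transpose_mul, transpose_transpose, Matrix.mul_assoc] using this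

lemma lintegral_gramWeight_conj' {k : ℕ} {F : Matrix (Fin k) (Fin k) ℝ → ENNReal}
    (hF : Measurable F) {S : Matrix (Fin k) (Fin k) ℝ} (hS : S.PosDef) :
    ∫⁻ A : Matrix (Fin k) (Fin k) ℝ, gramWeight A * F (Aᵀ * S * A) =
      ∫⁻ A : Matrix (Fin k) (Fin k) ℝ, gramWeight A * F (Aᵀ * A) := by
  obtain ⟨B, hB, rfl⟩ := exists_transpose_mul_self hS
  have := lintegral_gramWeight_mul_left B hB (F := fun A => F (Aᵀ * A))
    (hF.comp (measurable_matrix_mul (measurable_matrix_transpose measurable_id) measurable_id))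
  simpa only [transpose_mul, transpose_transpose, Matrix.mul_assoc] using this

/-! ### Gaussian integrals over matrices -/

lemma integrable_exp_trace (m k : ℕ) :
    Integrable fun Z : Matrix (Fin m) (Fin k) ℝ => Real.exp (-(1 / 2) * (Zᵀ * Z).trace) := by
  have h1 : Integrable fun x : ℝ => Real.exp (-(1 / 2) * x ^ 2) :=
    integrable_exp_neg_mul_sq (by norm_num)
  have h2 : Integrable fun x : Fin k → ℝ => ∏ j, Real.exp (-(1 / 2) * x j ^ 2) :=
    Integrable.fintype_prod fun _ => h1
  have h3 : Integrable fun Z : Fin m → Fin k → ℝ => ∏ i, ∏ j, Real.exp (-(1 / 2) * Z i j ^ 2) :=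
    Integrable.fintype_prod fun _ => h2
  refine (integrable_congr (Filter.Eventually.of_forall fun Z => ?_)).1 h3
  simp only [← Real.exp_sum, ← Finset.mul_sum]
  congr 2
  rw [Finset.sum_comm]
  simp [trace, mul_apply, sq]

lemma gramWeight_mul_wishartWeight {k : ℕ} {A : Matrix (Fin k) (Fin k) ℝ}
    (hA : 0 < (Aᵀ * A).det) :
    gramWeight A * wishartWeight k (Aᵀ * A) =
      ENNReal.ofReal (Real.exp (-(1 / 2) * (Aᵀ * A).trace)) := by
  rw [gramWeight, wishartWeight, ← ENNReal.ofReal_mul (Real.rpow_nonneg hA.le _), ← mul_assoc,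
    ← Real.rpow_add hA, show -(k : ℝ) / 2 + (k : ℝ) / 2 = 0 by ring, Real.rpow_zero, one_mul]

lemma lintegral_gramWeight_mul_wishartWeight (k : ℕ) :
    ∫⁻ A : Matrix (Fin k) (Fin k) ℝ, gramWeight A * wishartWeight k (Aᵀ * A) =
      ∫⁻ A : Matrix (Fin k) (Fin k) ℝ,
        ENNReal.ofReal (Real.exp (-(1 / 2) * (Aᵀ * A).trace)) := by
  refine lintegral_congr_ae ?_
  filter_upwards [ae_det_pos le_rfl (PosDef.one : (1 : Matrix (Fin k) (Fin k) ℝ).PosDef)] with A hA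
  rw [Matrix.mul_one] at hA
  exact gramWeight_mul_wishartWeight hA

lemma lintegral_exp_trace_ne_zero (m k : ℕ) :
    ∫⁻ Z : Matrix (Fin m) (Fin k) ℝ,
      ENNReal.ofReal (Real.exp (-(1 / 2) * (Zᵀ * Z).trace)) ≠ 0 := by
  intro h
  rw [lintegral_eq_zero_iff'
    (integrable_exp_trace m k).aestronglyMeasurable.aemeasurable.ennreal_ofReal] at h
  obtain ⟨Z, hZ⟩ := h.exists
  exact (ENNReal.ofReal_pos.2 (Real.exp_pos _)).ne' hZ

/-- Weighted integrals of a function of the column space do not depend on the quadratic form in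
the weight. -/
lemma lintegral_mul_wishartWeight_eq {m k : ℕ} (hk : k ≤ m)
    {H : Matrix (Fin m) (Fin k) ℝ → ENNReal} (hH : Measurable H)
    (hHA : ∀ Z (A : Matrix (Fin k) (Fin k) ℝ), A.det ≠ 0 → H (Z * A) = H Z)
    {T : Matrix (Fin m) (Fin m) ℝ} (hT : T.PosDef) :
    ∫⁻ Z, gramWeight Z * (H Z * wishartWeight m (Zᵀ * T * Z)) =
      ∫⁻ Z, gramWeight Z * (H Z * wishartWeight m (Zᵀ * Z)) := by
  -- Only `c` is cancelled at the end. It is a Gaussian integral, hence positive and finite; nothing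
  -- is required of `d`.
  set c : ENNReal := ∫⁻ A : Matrix (Fin k) (Fin k) ℝ, gramWeight A * wishartWeight k (Aᵀ * A)
    with hc
  set d : ENNReal := ∫⁻ A : Matrix (Fin k) (Fin k) ℝ, gramWeight A * wishartWeight m (A * Aᵀ)
    with hd
  have hc0 : c ≠ 0 := by
    rw [hc, lintegral_gramWeight_mul_wishartWeight]
    exact lintegral_exp_trace_ne_zero k k
  have hct : c ≠ ⊤ := by
    rw [hc, lintegral_gramWeight_mul_wishartWeight]
    exact (integrable_exp_trace k k).lintegral_lt_top.ne
  -- The right-hand side does not contain `T`, so comparison with `T = 1` finishes.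
  suffices key : ∀ {T : Matrix (Fin m) (Fin m) ℝ}, T.PosDef →
      (∫⁻ Z, gramWeight Z * (H Z * wishartWeight m (Zᵀ * T * Z))) * c =
        (∫⁻ Z, gramWeight Z * (H Z * wishartWeight k (Zᵀ * Z)⁻¹)) * d by
    have h1 := (key hT).trans (key PosDef.one).symm
    simp only [Matrix.mul_one] at h1
    exact (ENNReal.mul_left_inj hc0 hct).1 h1
  intro T hT
  have mT : Measurable fun Z : Matrix (Fin m) (Fin k) ℝ => Zᵀ * T * Z :=
    measurable_matrix_mul (measurable_matrix_mul (measurable_matrix_transpose measurable_id)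
      measurable_const) measurable_id
  have mI : Measurable fun Z : Matrix (Fin m) (Fin k) ℝ => (Zᵀ * Z)⁻¹ :=
    measurable_matrix_inv (measurable_matrix_mul (measurable_matrix_transpose measurable_id)
      measurable_id)
  have mF : Measurable fun p : Matrix (Fin m) (Fin k) ℝ × Matrix (Fin k) (Fin k) ℝ =>
      H p.1 * wishartWeight m (p.1ᵀ * T * p.1) *
        wishartWeight k (p.2ᵀ * (p.1ᵀ * p.1)⁻¹ * p.2) :=
    ((hH.comp measurable_fst).mul ((measurable_wishartWeight m k).comp
      (mT.comp measurable_fst))).mul ((measurable_wishartWeight k k).comp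
      (measurable_matrix_mul (measurable_matrix_mul (measurable_matrix_transpose measurable_snd)
        (mI.comp measurable_fst)) measurable_snd))
  have mF' : Measurable fun p : Matrix (Fin m) (Fin k) ℝ × Matrix (Fin k) (Fin k) ℝ =>
      H p.1 * wishartWeight m (p.2 * (p.1ᵀ * T * p.1) * p.2ᵀ) *
        wishartWeight k (p.1ᵀ * p.1)⁻¹ :=
    ((hH.comp measurable_fst).mul ((measurable_wishartWeight m k).comp
      (measurable_matrix_mul (measurable_matrix_mul measurable_snd (mT.comp measurable_fst))
        (measurable_matrix_transpose measurable_snd)))).mul ((measurable_wishartWeight k k).comp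
      (mI.comp measurable_fst))
  have mW : Measurable fun p : Matrix (Fin m) (Fin k) ℝ × Matrix (Fin k) (Fin k) ℝ =>
      gramWeight p.1 * gramWeight p.2 :=
    (measurable_gramWeight.comp measurable_fst).mul (measurable_gramWeight.comp measurable_snd)
  calc (∫⁻ Z, gramWeight Z * (H Z * wishartWeight m (Zᵀ * T * Z))) * c
      = ∫⁻ Z, ∫⁻ A : Matrix (Fin k) (Fin k) ℝ, gramWeight Z * gramWeight A *
          (H Z * wishartWeight m (Zᵀ * T * Z) * wishartWeight k (Aᵀ * (Zᵀ * Z)⁻¹ * A)) := by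
        rw [← lintegral_mul_const' _ _ hct]
        refine lintegral_congr_ae ?_
        filter_upwards [ae_injective hk] with Z hZ
        have hS : (Zᵀ * Z)⁻¹.PosDef := by
          simpa using (posDef_transpose_mul_mul PosDef.one hZ).inv
        -- For fixed `Z`, `c` may be computed with `Aᵀ(ZᵀZ)⁻¹A` in place of `AᵀA`.
        rw [hc, ← lintegral_gramWeight_conj' (measurable_wishartWeight k k) hS,
          ← lintegral_const_mul]
        · refine lintegral_congr fun A => ?_
          ring
        · exact measurable_gramWeight.mul ((measurable_wishartWeight k k).comp
            (measurable_matrix_mul (measurable_matrix_mul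
              (measurable_matrix_transpose measurable_id) measurable_const) measurable_id))
    _ = ∫⁻ A : Matrix (Fin k) (Fin k) ℝ, ∫⁻ Z : Matrix (Fin m) (Fin k) ℝ,
          gramWeight Z * gramWeight A *
          (H Z * wishartWeight m (Zᵀ * T * Z) * wishartWeight k (Aᵀ * (Zᵀ * Z)⁻¹ * A)) :=
        lintegral_lintegral_swap (mW.mul mF).aemeasurable
    _ = ∫⁻ A : Matrix (Fin k) (Fin k) ℝ, ∫⁻ Z : Matrix (Fin m) (Fin k) ℝ,
          gramWeight Z * gramWeight A *
          (H Z * wishartWeight m (A * (Zᵀ * T * Z) * Aᵀ) * wishartWeight k (Zᵀ * Z)⁻¹) := by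
        refine lintegral_congr_ae ?_
        filter_upwards [ae_injective (le_refl k)] with A hA
        have hdet : IsUnit A.det := (isUnit_iff_isUnit_det _).1 (mulVec_injective_iff_isUnit.1 hA)
        have hdet' : IsUnit Aᵀ.det := by rwa [det_transpose]
        have hmeas := mF.comp (measurable_id.prodMk (measurable_const (a := A)))
        simp only [mul_right_comm _ (gramWeight A)]
        have hA' : gramWeight A ≠ ⊤ := ENNReal.ofReal_ne_top
        rw [lintegral_mul_const' _ _ hA', lintegral_mul_const' _ _ hA']
        congr 1
        -- Under `Z ↦ ZAᵀ`, `H` is unchanged, `ZᵀTZ` becomes `A(ZᵀTZ)Aᵀ`, and `Aᵀ(ZᵀZ)⁻¹A` becomes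
        -- `(ZᵀZ)⁻¹`.
        refine (lintegral_gramWeight_mul_right Aᵀ hdet'.ne_zero hmeas).symm.trans ?_
        refine lintegral_congr fun Z => ?_
        simp only [Function.comp_apply, id_eq]
        rw [hHA Z _ hdet'.ne_zero]
        congr 4
        · simp only [transpose_mul, transpose_transpose, Matrix.mul_assoc]
        · rw [transpose_mul, transpose_transpose]
          have e : A * Zᵀ * (Z * Aᵀ) = A * (Zᵀ * Z) * Aᵀ := by simp only [Matrix.mul_assoc]
          rw [e, Matrix.mul_inv_rev, Matrix.mul_inv_rev, Matrix.mul_assoc, Matrix.mul_assoc, Matrix.mul_assoc,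
            nonsing_inv_mul _ hdet, Matrix.mul_one, mul_nonsing_inv_cancel_left _ _ hdet']
    _ = ∫⁻ Z : Matrix (Fin m) (Fin k) ℝ, ∫⁻ A : Matrix (Fin k) (Fin k) ℝ,
          gramWeight Z * gramWeight A *
          (H Z * wishartWeight m (A * (Zᵀ * T * Z) * Aᵀ) * wishartWeight k (Zᵀ * Z)⁻¹) :=
        (lintegral_lintegral_swap (mW.mul mF').aemeasurable).symm
    _ = (∫⁻ Z, gramWeight Z * (H Z * wishartWeight k (Zᵀ * Z)⁻¹)) * d := by
        refine Eq.trans (lintegral_congr_ae ?_) (lintegral_mul_const _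
          (measurable_gramWeight.mul (hH.mul ((measurable_wishartWeight k k).comp mI))))
        filter_upwards [ae_injective hk] with Z hZ
        -- `T` now occurs only in the positive definite matrix `ZᵀTZ` conjugated by `A`; the
        -- integral over `A` is `d` whatever that matrix is.
        rw [hd, ← lintegral_gramWeight_conj (measurable_wishartWeight m k)
          (posDef_transpose_mul_mul hT hZ), ← lintegral_const_mul]
        · refine lintegral_congr fun A => ?_
          ring
        · exact measurable_gramWeight.mul ((measurable_wishartWeight m k).comp
            (measurable_matrix_mul (measurable_matrix_mul measurable_id measurable_const)
              (measurable_matrix_transpose measurable_id)))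

/-! ### Uniqueness of the invariant probability measure -/

lemma rotate_mul {m k : ℕ} (U V : Matrix.orthogonalGroup (Fin m) ℝ) (P : Gr m k) :
    rotate (U * V) P = rotate U (rotate V P) := by
  apply Subtype.ext
  simp [rotate, Matrix.transpose_mul, Matrix.mul_assoc]

/-- Transitivity follows by diagonalizing `P`: its eigenvalues are `0` or `1`, exactly `k` are
nonzero, and a permutation of the eigenvectors brings those to the first `k` places. -/
lemma exists_rotate_basePoint {m k : ℕ} (hk : k ≤ m) (P : Gr m k) :
    ∃ V : Matrix.orthogonalGroup (Fin m) ℝ, rotate V (basePoint hk) = P := by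
  obtain ⟨P, h1, h2, h3⟩ := P
  have hP : P.IsHermitian := by rwa [IsHermitian, conjTranspose_eq_transpose_of_trivial]
  set U : Matrix (Fin m) (Fin m) ℝ := hP.eigenvectorUnitary.1
  have hUU : U * Uᵀ = 1 := ortho_mul_transpose hP.eigenvectorUnitary
  have hUU' : Uᵀ * U = 1 := ortho_transpose_mul hP.eigenvectorUnitary
  have hs : P = U * diagonal hP.eigenvalues * Uᵀ := by
    have := hP.spectral_theorem
    rw [Unitary.conjStarAlgAut_apply] at this
    simpa [star_eq_conjTranspose] using this
  have hd : diagonal hP.eigenvalues = Uᵀ * P * U := by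
    nth_rw 2 [hs]
    simp only [Matrix.mul_assoc]
    rw [hUU', Matrix.mul_one, ← Matrix.mul_assoc, hUU', Matrix.one_mul]
  have hidem : ∀ i, hP.eigenvalues i * hP.eigenvalues i = hP.eigenvalues i := by
    have : diagonal hP.eigenvalues * diagonal hP.eigenvalues = diagonal hP.eigenvalues := by
      rw [hd]
      calc Uᵀ * P * U * (Uᵀ * P * U) = Uᵀ * P * (U * Uᵀ) * P * U := by
            simp only [Matrix.mul_assoc]
        _ = Uᵀ * (P * P) * U := by rw [hUU, Matrix.mul_one, Matrix.mul_assoc Uᵀ]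
        _ = Uᵀ * P * U := by rw [h2]
    rw [diagonal_mul_diagonal] at this
    exact congrFun (diagonal_injective this)
  have hcard : Fintype.card {i : Fin m // (i : ℕ) < k} =
      Fintype.card {i // hP.eigenvalues i ≠ 0} := by
    rw [← hP.rank_eq_card_non_zero_eigs, h3, Fintype.card_subtype, Fin.card_filter_val_lt,
      min_eq_right hk]
  let e := Fintype.equivOfCardEq hcard
  let σ : Equiv.Perm (Fin m) := e.extendSubtype
  have hb : diagonal (fun i : Fin m => if (i : ℕ) < k then (1 : ℝ) else 0) =
      (diagonal hP.eigenvalues).submatrix σ σ := by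
    rw [submatrix_diagonal_equiv]
    congr 1
    funext i
    rw [Function.comp_apply]
    split_ifs with hi
    · exact (mul_left_cancel₀ (e.extendSubtype_mem i hi)
        ((hidem (σ i)).trans (mul_one _).symm)).symm
    · exact (not_not.1 (e.extendSubtype_not_mem i hi)).symm
  refine ⟨⟨U.submatrix id σ, (Matrix.mem_orthogonalGroup_iff _ _).2 ?_⟩, Subtype.ext ?_⟩
  · rw [transpose_submatrix, submatrix_mul_equiv, hUU]
    simp
  · change U.submatrix id σ * diagonal (fun i : Fin m => if (i : ℕ) < k then (1 : ℝ) else 0) *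
      (U.submatrix id σ)ᵀ = P
    rw [hb, transpose_submatrix, submatrix_mul_equiv, submatrix_mul_equiv, ← hs]
    simp

/-- A right translate of Haar measure is left invariant, hence a scalar multiple of it; the total
mass forces the scalar to be `1`. -/
instance instIsMulRightInvariantOrthoHaar (m : ℕ) : (orthoHaar m).IsMulRightInvariant := by
  refine ⟨fun g => ?_⟩
  have : IsFiniteMeasure (orthoHaar m) := ⟨by rw [orthoHaar_univ]; exact ENNReal.one_lt_top⟩
  have : (orthoHaar m).IsHaarMeasure := Measure.isHaarMeasure_haarMeasure _
  have h := Measure.isMulInvariant_eq_smul_of_compactSpace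
    ((orthoHaar m).map (· * g)) (orthoHaar m)
  have hu := congrArg (fun ν : Measure _ => ν Set.univ) h
  simp only [Measure.smul_apply, orthoHaar_univ] at hu
  rw [Measure.map_apply (continuous_mul_const g).measurable MeasurableSet.univ, Set.preimage_univ,
    orthoHaar_univ, ENNReal.smul_def, smul_eq_mul, mul_one] at hu
  rw [h, ENNReal.coe_eq_one.1 hu.symm, one_smul]

lemma orthoHaar_map_rotate {m k : ℕ} (hk : k ≤ m) (P : Gr m k) :
    (orthoHaar m).map (fun U => rotate U P) = grassmannHaar hk := by
  obtain ⟨V, rfl⟩ := exists_rotate_basePoint hk P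
  have h : (fun U => rotate U (rotate V (basePoint hk))) =
      (fun U => rotate U (basePoint hk)) ∘ fun U => U * V := by
    funext U
    exact (rotate_mul U V _).symm
  rw [h, ← Measure.map_map (continuous_rotate _).measurable (continuous_mul_const V).measurable,
    map_mul_right_eq_self, grassmannHaar]

/-- Average `g` over the rotations and exchange the integrals: the average over `U` of `g` at
`rotate U P` is the same for every `P`, by transitivity and right invariance. -/
lemma eq_grassmannHaar {m k : ℕ} (hk : k ≤ m) (ν : Measure (Gr m k)) [IsProbabilityMeasure ν]
    (hν : ∀ U : Matrix.orthogonalGroup (Fin m) ℝ, ν.map (rotate U) = ν) :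
    ν = grassmannHaar hk := by
  have : IsProbabilityMeasure (orthoHaar m) := ⟨orthoHaar_univ m⟩
  refine Measure.ext_of_lintegral _ fun g hg => ?_
  have hc : Continuous fun p : Matrix.orthogonalGroup (Fin m) ℝ × Gr m k => rotate p.1 p.2 := by
    unfold rotate
    fun_prop
  calc ∫⁻ P, g P ∂ν = ∫⁻ U, ∫⁻ P, g (rotate U P) ∂ν ∂(orthoHaar m) := by
        have : ∀ U, ∫⁻ P, g (rotate U P) ∂ν = ∫⁻ P, g P ∂ν := fun U => by
          rw [← lintegral_map hg (continuous_rotate' U).measurable, hν]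
        simp [this]
    _ = ∫⁻ P, ∫⁻ U, g (rotate U P) ∂(orthoHaar m) ∂ν :=
        lintegral_lintegral_swap (hg.comp hc.measurable).aemeasurable
    _ = ∫⁻ P, g P ∂(grassmannHaar hk) := by
        have : ∀ P : Gr m k, ∫⁻ U, g (rotate U P) ∂(orthoHaar m) =
            ∫⁻ P, g P ∂(grassmannHaar hk) := fun P => by
          rw [← lintegral_map hg (continuous_rotate P).measurable, orthoHaar_map_rotate hk]
        simp [this]

/-! ### The column space as a point of the Grassmann manifold -/

lemma colProj_mul_self {m k : ℕ} {Z : Matrix (Fin m) (Fin k) ℝ} (hZ : IsUnit (Zᵀ * Z).det) :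
    colProj Z * Z = Z := by
  rw [colProj, Matrix.mul_assoc, Matrix.mul_assoc, nonsing_inv_mul _ hZ, Matrix.mul_one]

lemma colProj_mem {m k : ℕ} {Z : Matrix (Fin m) (Fin k) ℝ} (hZ : IsUnit (Zᵀ * Z).det) :
    (colProj Z)ᵀ = colProj Z ∧ colProj Z * colProj Z = colProj Z ∧ (colProj Z).rank = k := by
  refine ⟨?_, ?_, le_antisymm ?_ ?_⟩
  · simp [colProj, transpose_nonsing_inv, Matrix.mul_assoc]
  · nth_rw 2 [colProj]
    rw [← Matrix.mul_assoc, ← Matrix.mul_assoc, colProj_mul_self hZ, colProj]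
  · rw [colProj, Matrix.mul_assoc]
    exact (rank_mul_le_left _ _).trans (rank_le_width _)
  · calc k = (Zᵀ * Z).rank := by
          rw [rank_of_isUnit _ ((isUnit_iff_isUnit_det _).2 hZ), Fintype.card_fin]
      _ = (Zᵀ * (colProj Z * Z)).rank := by rw [colProj_mul_self hZ]
      _ ≤ (colProj Z).rank := (rank_mul_le_right _ _).trans (rank_mul_le_left _ _)

lemma range_colProj {m k : ℕ} {Z : Matrix (Fin m) (Fin k) ℝ} (hZ : IsUnit (Zᵀ * Z).det) :
    LinearMap.range (colProj Z).mulVecLin = LinearMap.range Z.mulVecLin := by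
  apply le_antisymm
  · rw [colProj, Matrix.mul_assoc, mulVecLin_mul]
    exact LinearMap.range_comp_le_range _ _
  · nth_rw 1 [← colProj_mul_self hZ]
    rw [mulVecLin_mul]
    exact LinearMap.range_comp_le_range _ _

open Classical in
/-- The column space of a matrix of full rank; an arbitrary subspace for other matrices. -/
noncomputable def colSpan {m k : ℕ} (hk : k ≤ m) (Z : Matrix (Fin m) (Fin k) ℝ) : Gr m k :=
  if hZ : IsUnit (Zᵀ * Z).det then ⟨colProj Z, colProj_mem hZ⟩ else basePoint hk

lemma coe_colSpan {m k : ℕ} (hk : k ≤ m) {Z : Matrix (Fin m) (Fin k) ℝ}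
    (hZ : IsUnit (Zᵀ * Z).det) : (colSpan hk Z : Matrix (Fin m) (Fin m) ℝ) = colProj Z := by
  rw [colSpan, dif_pos hZ]

lemma measurable_colProj {m k : ℕ} :
    Measurable (colProj : Matrix (Fin m) (Fin k) ℝ → Matrix (Fin m) (Fin m) ℝ) :=
  measurable_matrix_mul (measurable_matrix_mul measurable_id (measurable_matrix_inv
    (measurable_matrix_mul (measurable_matrix_transpose measurable_id) measurable_id)))
    (measurable_matrix_transpose measurable_id)

lemma measurable_colSpan {m k : ℕ} (hk : k ≤ m) :
    Measurable (colSpan hk : Matrix (Fin m) (Fin k) ℝ → Gr m k) := by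
  classical
  have hs : MeasurableSet {Z : Matrix (Fin m) (Fin k) ℝ | IsUnit (Zᵀ * Z).det} := by
    simp only [isUnit_iff_ne_zero]
    exact (isOpen_ne_fun (by fun_prop) continuous_const).measurableSet
  have h : Measurable fun Z : Matrix (Fin m) (Fin k) ℝ =>
      (colSpan hk Z : Matrix (Fin m) (Fin m) ℝ) := by
    have : Measurable fun Z : Matrix (Fin m) (Fin k) ℝ =>
        if IsUnit (Zᵀ * Z).det then colProj Z else (basePoint hk : Matrix (Fin m) (Fin m) ℝ) :=
      Measurable.ite hs measurable_colProj measurable_const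
    convert this using 2 with Z
    rw [colSpan]
    split_ifs <;> rfl
  exact h.subtype_mk

/-- No rank condition on `Z` is needed: if `Z` is rank deficient, so is `ZA`, and both sides take
the default value. Left multiplication by `U` does need one, as rotations may move that default. -/
lemma colSpan_mul_right {m k : ℕ} (hk : k ≤ m) (Z : Matrix (Fin m) (Fin k) ℝ)
    (A : Matrix (Fin k) (Fin k) ℝ) (hA : A.det ≠ 0) : colSpan hk (Z * A) = colSpan hk Z := by
  have hA' : IsUnit A.det := isUnit_iff_ne_zero.2 hA
  have hT : IsUnit Aᵀ.det := by rwa [det_transpose]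
  have e : (Z * A)ᵀ * (Z * A) = Aᵀ * (Zᵀ * Z) * A := by
    simp only [transpose_mul, Matrix.mul_assoc]
  have hiff : IsUnit ((Z * A)ᵀ * (Z * A)).det ↔ IsUnit (Zᵀ * Z).det := by
    rw [e, det_mul, det_mul, isUnit_iff_ne_zero, isUnit_iff_ne_zero]
    simp [hA]
  by_cases hZ : IsUnit (Zᵀ * Z).det
  · apply Subtype.ext
    rw [coe_colSpan hk hZ, coe_colSpan hk (hiff.2 hZ), colProj, colProj, e, Matrix.mul_inv_rev,
      Matrix.mul_inv_rev, transpose_mul]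
    calc Z * A * (A⁻¹ * ((Zᵀ * Z)⁻¹ * Aᵀ⁻¹)) * (Aᵀ * Zᵀ)
        = Z * (A * A⁻¹) * (Zᵀ * Z)⁻¹ * (Aᵀ⁻¹ * Aᵀ) * Zᵀ := by simp only [Matrix.mul_assoc]
      _ = Z * (Zᵀ * Z)⁻¹ * Zᵀ := by
        rw [mul_nonsing_inv _ hA', nonsing_inv_mul _ hT, Matrix.mul_one, Matrix.mul_one]
  · rw [colSpan, colSpan, dif_neg hZ, dif_neg (mt hiff.1 hZ)]

lemma colSpan_mul_left {m k : ℕ} (hk : k ≤ m) (U : Matrix.orthogonalGroup (Fin m) ℝ)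
    {Z : Matrix (Fin m) (Fin k) ℝ} (hZ : IsUnit (Zᵀ * Z).det) :
    colSpan hk ((U : Matrix (Fin m) (Fin m) ℝ) * Z) = rotate U (colSpan hk Z) := by
  have e : ((U : Matrix (Fin m) (Fin m) ℝ) * Z)ᵀ * ((U : Matrix (Fin m) (Fin m) ℝ) * Z) =
      Zᵀ * Z := by
    calc _ = Zᵀ * ((U : Matrix (Fin m) (Fin m) ℝ)ᵀ * (U : Matrix (Fin m) (Fin m) ℝ)) * Z := by
          simp only [transpose_mul, Matrix.mul_assoc]
      _ = Zᵀ * Z := by rw [ortho_transpose_mul, Matrix.mul_one]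
  apply Subtype.ext
  change _ = (U : Matrix (Fin m) (Fin m) ℝ) * (colSpan hk Z).1 * (U : Matrix (Fin m) (Fin m) ℝ)ᵀ
  rw [coe_colSpan hk (by rwa [e]), coe_colSpan hk hZ, colProj, colProj, e]
  simp only [transpose_mul, Matrix.mul_assoc]

/-! ### The centred matrix normal distribution -/

lemma matrixNormalPDF_zero_one {m k : ℕ} (M : Matrix (Fin m) (Fin m) ℝ)
    (Z : Matrix (Fin m) (Fin k) ℝ) :
    matrixNormalPDF 0 M 1 Z = (2 * Real.pi) ^ (-((m : ℝ) * (k : ℝ)) / 2) * M.det ^ (-(k : ℝ) / 2) *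
      Real.exp (-(1 / 2) * (Zᵀ * M⁻¹ * Z).trace) := by
  rw [matrixNormalPDF, sub_zero, inv_one, Matrix.mul_one, det_one, Real.one_rpow, mul_one,
    trace_smul, smul_eq_mul, trace_mul_comm, ← Matrix.mul_assoc]

lemma measurable_matrixNormalPDF {m k : ℕ} (M : Matrix (Fin m) (Fin m) ℝ) :
    Measurable fun Z : Matrix (Fin m) (Fin k) ℝ => ENNReal.ofReal (matrixNormalPDF 0 M 1 Z) := by
  have h : Continuous fun Z : Matrix (Fin m) (Fin k) ℝ => (Zᵀ * M⁻¹ * Z).trace :=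
    Continuous.matrix_trace (by fun_prop)
  simp only [matrixNormalPDF_zero_one]
  exact ((h.measurable.const_mul _).exp.const_mul _).ennreal_ofReal

lemma lintegral_matrixNormal {m k : ℕ} (M : Matrix (Fin m) (Fin m) ℝ)
    {g : Matrix (Fin m) (Fin k) ℝ → ENNReal} (hg : Measurable g) :
    ∫⁻ Z, g Z ∂(matrixNormal 0 M 1) =
      ∫⁻ Z, ENNReal.ofReal (matrixNormalPDF 0 M 1 Z) * g Z := by
  rw [matrixNormal, lintegral_withDensity_eq_lintegral_mul _ (measurable_matrixNormalPDF M) hg]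
  rfl

/-- The Jacobian `|det C|^k` cancels `|CCᵀ|^(-k/2)`, and the quadratic form reduces to `ZᵀZ`. -/
lemma matrixNormal_map_mul_left {m k : ℕ} (C : Matrix (Fin m) (Fin m) ℝ) (hC : C.det ≠ 0) :
    (matrixNormal (k := k) 0 1 1).map (fun Z : Matrix (Fin m) (Fin k) ℝ => C * Z) =
      matrixNormal 0 (C * Cᵀ) 1 := by
  have hm : Measurable fun Z : Matrix (Fin m) (Fin k) ℝ => C * Z :=
    measurable_matrix_mul measurable_const measurable_id
  refine Measure.ext_of_lintegral _ fun g hg => ?_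
  rw [lintegral_map hg hm, lintegral_matrixNormal _ (g := fun Z => g (C * Z)) (hg.comp hm),
    lintegral_matrixNormal _ hg,
    ← lintegral_mul_left C hC
      (g := fun Z => ENNReal.ofReal (matrixNormalPDF 0 (C * Cᵀ) 1 Z) * g Z)
      ((measurable_matrixNormalPDF _).mul hg),
    ← lintegral_const_mul' _ _ ENNReal.ofReal_ne_top]
  refine lintegral_congr fun Z => ?_
  have hp : 0 < |C.det| ^ k := pow_pos (abs_pos.2 hC) k
  have hC' : IsUnit C.det := isUnit_iff_ne_zero.2 hC
  have hT : IsUnit Cᵀ.det := by rwa [det_transpose]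
  rw [← mul_assoc, ← ENNReal.ofReal_mul hp.le]
  congr 2
  have e : (C * Z)ᵀ * (C * Cᵀ)⁻¹ * (C * Z) = Zᵀ * Z := by
    rw [Matrix.mul_inv_rev, transpose_mul]
    calc Zᵀ * Cᵀ * (Cᵀ⁻¹ * C⁻¹) * (C * Z) = Zᵀ * (Cᵀ * Cᵀ⁻¹) * (C⁻¹ * C) * Z := by
          simp only [Matrix.mul_assoc]
      _ = Zᵀ * Z := by
          rw [mul_nonsing_inv _ hT, nonsing_inv_mul _ hC', Matrix.mul_one, Matrix.mul_one]
  rw [matrixNormalPDF_zero_one, matrixNormalPDF_zero_one, e, det_mul, det_transpose, ← sq,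
    sq_rpow_neg_half, det_one, Real.one_rpow, inv_one, Matrix.mul_one]
  field_simp

/-- The normalizing constant is never computed: total mass one is carried over from `M` to the
identity by a linear map. -/
lemma isProbabilityMeasure_matrixNormal_one {m k : ℕ} {M : Matrix (Fin m) (Fin m) ℝ}
    (hM : M.PosDef) (h : IsProbabilityMeasure (matrixNormal (k := k) 0 M 1)) :
    IsProbabilityMeasure (matrixNormal (m := m) (k := k) 0 1 1) := by
  obtain ⟨B, hB, rfl⟩ := exists_transpose_mul_self hM
  have hm : Measurable fun Z : Matrix (Fin m) (Fin k) ℝ => Bᵀ * Z :=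
    measurable_matrix_mul measurable_const measurable_id
  have := matrixNormal_map_mul_left (k := k) Bᵀ (by rwa [det_transpose])
  rw [transpose_transpose] at this
  constructor
  rw [← Set.preimage_univ (f := fun Z : Matrix (Fin m) (Fin k) ℝ => Bᵀ * Z),
    ← Measure.map_apply hm MeasurableSet.univ, this]
  exact h.measure_univ

lemma ae_isUnit_det {m k : ℕ} (hk : k ≤ m) :
    ∀ᵐ Z : Matrix (Fin m) (Fin k) ℝ, IsUnit (Zᵀ * Z).det := by
  filter_upwards [ae_det_pos hk (PosDef.one : (1 : Matrix (Fin m) (Fin m) ℝ).PosDef)] with Z hZ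
  rw [Matrix.mul_one] at hZ
  exact isUnit_iff_ne_zero.2 hZ.ne'

lemma matrixNormal_absolutelyContinuous {m k : ℕ} (A : Matrix (Fin m) (Fin k) ℝ)
    (Λ₁ : Matrix (Fin m) (Fin m) ℝ) (Λ₂ : Matrix (Fin k) (Fin k) ℝ) :
    matrixNormal A Λ₁ Λ₂ ≪ volume :=
  withDensity_absolutelyContinuous _ _

/-- The column space of a standard normal matrix is uniformly distributed. -/
lemma matrixNormal_one_map_colSpan {m k : ℕ} (hk : k ≤ m)
    (h : IsProbabilityMeasure (matrixNormal (m := m) (k := k) 0 1 1)) :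
    (matrixNormal 0 1 1).map (colSpan hk) = grassmannHaar hk := by
  have : IsProbabilityMeasure ((matrixNormal 0 1 1).map (colSpan hk)) :=
    Measure.isProbabilityMeasure_map (measurable_colSpan hk).aemeasurable
  refine eq_grassmannHaar hk _ fun U => ?_
  have hU := ortho_mul_transpose U
  have hd : (U : Matrix (Fin m) (Fin m) ℝ).det ≠ 0 :=
    ((isUnit_iff_isUnit_det _).1 (IsUnit.of_mul_eq_one _ hU)).ne_zero
  have hm : Measurable fun Z : Matrix (Fin m) (Fin k) ℝ => (U : Matrix (Fin m) (Fin m) ℝ) * Z :=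
    measurable_matrix_mul measurable_const measurable_id
  have hN := matrixNormal_map_mul_left (k := k) _ hd
  rw [hU] at hN
  rw [Measure.map_map (continuous_rotate' U).measurable (measurable_colSpan hk)]
  nth_rw 2 [← hN]
  rw [Measure.map_map (measurable_colSpan hk) hm]
  refine Measure.map_congr ?_
  filter_upwards [(matrixNormal_absolutelyContinuous 0 1 1).ae_le (ae_isUnit_det hk)] with Z hZ
  exact (colSpan_mul_left hk U hZ).symm

/-! ### The angular density -/

lemma measurable_macgPDF {m k : ℕ} (M : Matrix (Fin m) (Fin m) ℝ) :
    Measurable fun P : Gr m k => ENNReal.ofReal (macgPDF M P) := by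
  have h : Continuous fun P : Gr m k => (1 - P.1 + M⁻¹ * P.1).det := by fun_prop
  exact ((h.measurable.pow_const _).const_mul _).ennreal_ofReal

/-- The identity `|I + XY| = |I + YX|` with `X = (T - 1)Z`, `Y = (ZᵀZ)⁻¹Zᵀ` reduces to a `k × k`
determinant. -/
lemma det_one_sub_colProj_add {m k : ℕ} (T : Matrix (Fin m) (Fin m) ℝ)
    {Z : Matrix (Fin m) (Fin k) ℝ} (hZ : IsUnit (Zᵀ * Z).det) :
    (1 - colProj Z + T * colProj Z).det = (Zᵀ * T * Z).det / (Zᵀ * Z).det := by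
  have e : 1 - colProj Z + T * colProj Z = 1 + (T - 1) * Z * ((Zᵀ * Z)⁻¹ * Zᵀ) := by
    rw [colProj]
    simp only [Matrix.sub_mul, Matrix.one_mul, Matrix.mul_assoc]
    abel
  have e' : 1 + (Zᵀ * Z)⁻¹ * Zᵀ * ((T - 1) * Z) = (Zᵀ * Z)⁻¹ * (Zᵀ * T * Z) := by
    rw [Matrix.sub_mul, Matrix.one_mul, Matrix.mul_sub, Matrix.mul_assoc _ Zᵀ Z,
      nonsing_inv_mul _ hZ, add_sub_cancel]
    simp only [Matrix.mul_assoc]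
  rw [e, det_one_add_mul_comm, e', det_mul, det_nonsing_inv, Ring.inverse_eq_inv', div_eq_inv_mul]

lemma matrixNormalPDF_eq_macgPDF_mul {m k : ℕ} (hk : k ≤ m) {M : Matrix (Fin m) (Fin m) ℝ}
    (hM : M.PosDef) {Z : Matrix (Fin m) (Fin k) ℝ} (hZ : 0 < (Zᵀ * Z).det)
    (hZM : 0 < (Zᵀ * M⁻¹ * Z).det) :
    ENNReal.ofReal (matrixNormalPDF 0 M 1 Z) =
      ENNReal.ofReal ((2 * Real.pi) ^ (-((m : ℝ) * (k : ℝ)) / 2)) *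
        (gramWeight Z * (ENNReal.ofReal (macgPDF M (colSpan hk Z)) *
          wishartWeight m (Zᵀ * M⁻¹ * Z))) := by
  have hu : IsUnit (Zᵀ * Z).det := isUnit_iff_ne_zero.2 hZ.ne'
  have hd := hM.det_pos
  rw [matrixNormalPDF_zero_one, macgPDF, coe_colSpan hk hu, det_one_sub_colProj_add _ hu, gramWeight,
    wishartWeight, ← ENNReal.ofReal_mul (by positivity), ← ENNReal.ofReal_mul (by positivity),
    ← ENNReal.ofReal_mul (by positivity)]
  congr 1
  rw [neg_div, neg_div, Real.div_rpow hZM.le hZ.le, neg_div (2 : ℝ) (m : ℝ),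
    Real.rpow_neg hZM.le, Real.rpow_neg hZ.le]
  have h1 := (Real.rpow_pos_of_pos hZ ((m : ℝ) / 2)).ne'
  have h2 := (Real.rpow_pos_of_pos hZM ((m : ℝ) / 2)).ne'
  field_simp

lemma matrixNormal_map_colSpan {m k : ℕ} (hk : k ≤ m) {M : Matrix (Fin m) (Fin m) ℝ}
    (hM : M.PosDef) (h : IsProbabilityMeasure (matrixNormal (k := k) 0 M 1)) :
    (matrixNormal 0 M 1).map (colSpan hk) =
      (grassmannHaar hk).withDensity fun Q => ENNReal.ofReal (macgPDF M Q) := by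
  refine Measure.ext_of_lintegral _ fun g hg => ?_
  have hc := measurable_colSpan hk
  have hf : Measurable fun P : Gr m k => ENNReal.ofReal (macgPDF M P) * g P :=
    (measurable_macgPDF M).mul hg
  have hH : Measurable fun Z : Matrix (Fin m) (Fin k) ℝ =>
      ENNReal.ofReal (macgPDF M (colSpan hk Z)) * g (colSpan hk Z) := hf.comp hc
  have hM1 : (1 : Matrix (Fin m) (Fin m) ℝ).PosDef := PosDef.one
  -- Here `H` is the product of the angular density and `g`, and `T = M⁻¹`.
  have key := lintegral_mul_wishartWeight_eq hk hH
    (fun Z A hA => by rw [colSpan_mul_right hk Z A hA]) hM.inv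
  set c : ENNReal := ENNReal.ofReal ((2 * Real.pi) ^ (-((m : ℝ) * (k : ℝ)) / 2))
  have hct : c ≠ ⊤ := ENNReal.ofReal_ne_top
  calc ∫⁻ P, g P ∂((matrixNormal 0 M 1).map (colSpan hk))
      = ∫⁻ Z, ENNReal.ofReal (matrixNormalPDF 0 M 1 Z) * g (colSpan hk Z) := by
        rw [lintegral_map hg hc,
          lintegral_matrixNormal M (g := fun Z => g (colSpan hk Z)) (hg.comp hc)]
    _ = ∫⁻ Z, c * (gramWeight Z * (ENNReal.ofReal (macgPDF M (colSpan hk Z)) *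
          g (colSpan hk Z) * wishartWeight m (Zᵀ * M⁻¹ * Z))) := by
        refine lintegral_congr_ae ?_
        filter_upwards [ae_det_pos hk hM1, ae_det_pos hk hM.inv] with Z hZ hZM
        rw [Matrix.mul_one] at hZ
        rw [matrixNormalPDF_eq_macgPDF_mul hk hM hZ hZM]
        ring
    _ = ∫⁻ Z, c * (gramWeight Z * (ENNReal.ofReal (macgPDF M (colSpan hk Z)) *
          g (colSpan hk Z) * wishartWeight m (Zᵀ * Z))) := by
        rw [lintegral_const_mul' _ _ hct, lintegral_const_mul' _ _ hct, key]
    _ = ∫⁻ Z, ENNReal.ofReal (matrixNormalPDF 0 1 1 Z) *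
          (ENNReal.ofReal (macgPDF M (colSpan hk Z)) * g (colSpan hk Z)) := by
        refine lintegral_congr_ae ?_
        filter_upwards [ae_det_pos hk hM1] with Z hZ
        rw [Matrix.mul_one] at hZ
        -- For `M = I` the angular density is constantly one, so the same factorization, read
        -- backwards, yields the standard normal density.
        have h1 : ENNReal.ofReal (macgPDF 1 (colSpan hk Z)) = 1 := by
          simp [macgPDF]
        rw [matrixNormalPDF_eq_macgPDF_mul hk hM1 hZ (by rwa [inv_one, Matrix.mul_one]), h1,
          inv_one, Matrix.mul_one]
        ring
    _ = ∫⁻ P, g P ∂((grassmannHaar hk).withDensity fun Q => ENNReal.ofReal (macgPDF M Q)) := by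
        rw [lintegral_withDensity_eq_lintegral_mul _ (measurable_macgPDF M) hg,
          ← matrixNormal_one_map_colSpan hk (isProbabilityMeasure_matrixNormal_one hM h)]
        refine Eq.symm ((lintegral_map hf hc).trans ?_)
        rw [lintegral_matrixNormal 1 hH]

end GrassmannNormal

theorem proposition1 {m k : ℕ} (hk : k ≤ m) (M : Matrix (Fin m) (Fin m) ℝ) (hM : M.PosDef)
    {Ω : Type*} [MeasurableSpace Ω] (μ : Measure Ω) [IsProbabilityMeasure μ]
    (Z : Ω → Matrix (Fin m) (Fin k) ℝ)
    (hZ : ProbabilityTheory.HasLaw Z (GrassmannNormal.matrixNormal 0 M 1) μ) :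
    (∀ᵐ ω ∂μ, IsUnit ((Z ω)ᵀ * Z ω).det) ∧
    ∃ P : Ω → GrassmannNormal.Gr m k,
      (∀ᵐ ω ∂μ, (P ω : Matrix (Fin m) (Fin m) ℝ) = GrassmannNormal.colProj (Z ω) ∧
        LinearMap.range (P ω : Matrix (Fin m) (Fin m) ℝ).mulVecLin =
          LinearMap.range (Z ω).mulVecLin) ∧
      ProbabilityTheory.HasLaw P
        ((GrassmannNormal.grassmannHaar hk).withDensity
          fun Q => ENNReal.ofReal (GrassmannNormal.macgPDF M Q)) μ := by
  -- The total mass of the normal law comes from its being the law of `Z`.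
  have hprob : IsProbabilityMeasure (GrassmannNormal.matrixNormal (k := k) 0 M 1) :=
    hZ.isProbabilityMeasure_iff.1 inferInstance
  have hunit : ∀ᵐ ω ∂μ, IsUnit ((Z ω)ᵀ * Z ω).det := by
    have h := (GrassmannNormal.matrixNormal_absolutelyContinuous 0 M 1).ae_le
      (GrassmannNormal.ae_isUnit_det hk)
    rw [← hZ.map_eq] at h
    exact ae_of_ae_map hZ.aemeasurable h
  refine ⟨hunit, fun ω => GrassmannNormal.colSpan hk (Z ω), ?_, ?_⟩
  · filter_upwards [hunit] with ω hω
    rw [GrassmannNormal.coe_colSpan hk hω]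
    exact ⟨rfl, GrassmannNormal.range_colProj hω⟩
  · exact ProbabilityTheory.HasLaw.comp
      ⟨(GrassmannNormal.measurable_colSpan hk).aemeasurable,
        GrassmannNormal.matrixNormal_map_colSpan hk hM hprob⟩ hZ
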